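/- Let $n \ge 2$ and let $a_1, \ldots, a_{n-1}$ be arbitrary, but fixed, complex numbers. For $a \in \mathbb{C}$ set \[ h_a(z) = z^n + a_{n-1} z^{n-1} + a^n \quad\text{and}\quad f_a(z) = z^n + a_{n-1} z^{n-1} + \cdots + a_1 z + a^n . \] For a polynomial $p$ let $Z(p)$ be the multiset of its complex roots, counted with multiplicity. For two multisets $A=\{u_1,\dots,u_m\}$ and $B=\{v_1,\dots,v_m\}$ of $m$ complex numbers let \[ d_F(A,B) = \min_{\sigma} \max_{1 \le k \le m} |u_k - v_{\sigma(k)}| \] be their Fréchet distance, where $\sigma$ runs over the permutations of $\{1,\dots,m\}$. Then, for every $a\in\mathbb{C}$, both $Z(h_a)$ and $Z(f_a)$ have exactly $n$ elements (with multiplicity), and \[ \lim_{|a| \to +\infty} d_F\bigl(Z(h_a), Z(f_a)\bigr) = 0 , \] where $a$ ranges over the complex numbers. -/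

import Mathlib

open Polynomial Filter Topology

noncomputable section

/-- The Fréchet distance of two `m`-tuples of complex numbers: the minimum over all permutations
of the largest distance between paired entries. (Both index sets are finite, so the infimum is a
minimum and, for positive `m`, the supremum is a maximum.) -/
def frechetDistTuple {m : ℕ} (u v : Fin m → ℂ) : ℝ :=
  ⨅ σ : Equiv.Perm (Fin m), ⨆ k : Fin m, ‖u k - v (σ k)‖

/-- `u` enumerates the multiset `A` (with multiplicities). -/
def Enumerates {m : ℕ} (u : Fin m → ℂ) (A : Multiset ℂ) : Prop :=
  Finset.univ.val.map u = A

/-- The Fréchet distance of two finite multisets of complex numbers of the same cardinality: the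
Fréchet distance of any enumerations of them. The set below has exactly one element, see
`frechetDist_eq`. -/
def frechetDist (A B : Multiset ℂ) : ℝ :=
  sInf {d : ℝ | ∃ (m : ℕ) (u v : Fin m → ℂ),
    Enumerates u A ∧ Enumerates v B ∧ d = frechetDistTuple u v}

theorem Enumerates.exists_perm {m : ℕ} {u u' : Fin m → ℂ} {A : Multiset ℂ}
    (h : Enumerates u A) (h' : Enumerates u' A) : ∃ σ : Equiv.Perm (Fin m), u' = u ∘ σ := by
  have hcard : ∀ c : ℂ, Fintype.card {k // u' k = c} = Fintype.card {k // u k = c} := by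
    intro c
    have h2 : Multiset.count c (Finset.univ.val.map u') =
        Multiset.count c (Finset.univ.val.map u) := by
      rw [show Finset.univ.val.map u' = Finset.univ.val.map u from h'.trans h.symm]
    rw [Multiset.count_map, Multiset.count_map] at h2
    rw [Fintype.card_subtype, Fintype.card_subtype]
    simpa [Finset.card_def, Finset.filter_val, eq_comm] using h2
  have e : ∀ c : ℂ, {k // u' k = c} ≃ {k // u k = c} := fun c => Fintype.equivOfCardEq (hcard c)
  refine ⟨(Equiv.sigmaFiberEquiv u').symm.trans
    ((Equiv.sigmaCongrRight e).trans (Equiv.sigmaFiberEquiv u)), ?_⟩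
  funext k
  exact ((e (u' k) ⟨k, rfl⟩).2).symm

theorem frechetDistTuple_comp {m : ℕ} (u v : Fin m → ℂ) (σ τ : Equiv.Perm (Fin m)) :
    frechetDistTuple (u ∘ σ) (v ∘ τ) = frechetDistTuple u v := by
  unfold frechetDistTuple
  refine Equiv.iInf_congr
    (Equiv.ofBijective (fun ρ : Equiv.Perm (Fin m) => σ.symm.trans (ρ.trans τ)) ?_) ?_
  · refine ⟨fun a b hab => ?_, fun b => ⟨σ.trans (b.trans τ.symm), by ext; simp⟩⟩
    refine Equiv.ext fun k => ?_
    have := congrArg (fun f : Equiv.Perm (Fin m) => f (σ k)) hab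
    simpa using this
  · intro ρ
    exact (Equiv.iSup_congr σ (fun k => by
      change ‖u (σ k) - v (τ (ρ (σ.symm (σ k))))‖ = ‖u (σ k) - v (τ (ρ k))‖
      rw [Equiv.symm_apply_apply])).symm

/-- The Fréchet distance of multisets can be computed with any enumerations of them. -/
theorem frechetDist_eq {m : ℕ} {u v : Fin m → ℂ} {A B : Multiset ℂ}
    (hu : Enumerates u A) (hv : Enumerates v B) : frechetDist A B = frechetDistTuple u v := by
  have hset : {d : ℝ | ∃ (m : ℕ) (u v : Fin m → ℂ),
      Enumerates u A ∧ Enumerates v B ∧ d = frechetDistTuple u v} = {frechetDistTuple u v} := by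
    ext d
    constructor
    · rintro ⟨m', u', v', hu', hv', rfl⟩
      have hm : m' = m := by
        have h1 := congrArg Multiset.card (hu'.trans hu.symm)
        simpa using h1
      subst hm
      obtain ⟨σ, rfl⟩ := hu.exists_perm hu'
      obtain ⟨τ, rfl⟩ := hv.exists_perm hv'
      exact frechetDistTuple_comp u v σ τ
    · rintro rfl
      exact ⟨m, u, v, hu, hv, rfl⟩
  rw [frechetDist, hset, csInf_singleton]

/-- The polynomial `z ^ n + c (n - 1) * z ^ (n - 1) + ⋯ + c 1 * z + a ^ n`. -/
def fullPoly (n : ℕ) (c : ℕ → ℂ) (a : ℂ) : ℂ[X] :=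
  X ^ n + ∑ k ∈ Finset.Icc 1 (n - 1), C (c k) * X ^ k + C (a ^ n)

/-- The polynomial `z ^ n + c (n - 1) * z ^ (n - 1) + a ^ n`. -/
def truncPoly (n : ℕ) (c : ℕ → ℂ) (a : ℂ) : ℂ[X] :=
  X ^ n + C (c (n - 1)) * X ^ (n - 1) + C (a ^ n)

end

/-! For large `‖a‖` both polynomials are perturbations of `z ^ n + a ^ n`, whose roots `a * ζ k` are
separated by a multiple of `‖a‖`. At these points both have size `O(‖a‖ ^ (n - 1))`, so each has
exactly one root, `u k` resp. `v k`, within `s * ‖a‖` of `a * ζ k` (`exists_enumerates_near`). The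
two polynomials differ only in degrees at most `n - 2`, hence `∏ j, ‖u k - v j‖ = O(‖a‖ ^ (n - 2))`.
The `n - 1` factors with `j ≠ k` are at least `s * ‖a‖`, which leaves `‖u k - v k‖ = O(1 / ‖a‖)`. -/

/-- Lets every result on `fullPoly` serve for both polynomials. -/
theorem truncPoly_eq_fullPoly {n : ℕ} (hn : 2 ≤ n) (c : ℕ → ℂ) (a : ℂ) :
    truncPoly n c a = fullPoly n (fun k => if k = n - 1 then c k else 0) a := by
  have h : ∑ k ∈ Finset.Icc 1 (n - 1), C (if k = n - 1 then c k else 0) * X ^ k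
      = C (c (n - 1)) * (X : ℂ[X]) ^ (n - 1) := by
    rw [Finset.sum_eq_single (n - 1)]
    · simp
    · intro k _ hk
      simp [hk]
    · intro h
      exact absurd (Finset.mem_Icc.2 ⟨by omega, le_rfl⟩) h
  rw [truncPoly, fullPoly, h]

theorem degree_fullPoly_tail_lt {n : ℕ} (hn : 2 ≤ n) (c : ℕ → ℂ) (a : ℂ) :
    (∑ k ∈ Finset.Icc 1 (n - 1), C (c k) * X ^ k + C (a ^ n) : ℂ[X]).degree < n := by
  refine (degree_add_le _ _).trans_lt (max_lt ?_ ?_)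
  · refine (degree_sum_le _ _).trans_lt ?_
    refine (Finset.sup_lt_iff (WithBot.bot_lt_coe n)).2 fun k hk => ?_
    refine (degree_C_mul_X_pow_le _ _).trans_lt ?_
    rw [Finset.mem_Icc] at hk
    exact WithBot.coe_lt_coe.2 (by omega : k < n)
  · refine degree_C_le.trans_lt ?_
    exact_mod_cast (by omega : 0 < n)

theorem fullPoly_monic {n : ℕ} (hn : 2 ≤ n) (c : ℕ → ℂ) (a : ℂ) : (fullPoly n c a).Monic := by
  rw [fullPoly, add_assoc]
  exact monic_X_pow_add (degree_fullPoly_tail_lt hn c a)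

theorem card_roots_fullPoly {n : ℕ} (hn : 2 ≤ n) (c : ℕ → ℂ) (a : ℂ) :
    (fullPoly n c a).roots.card = n := by
  rw [← (IsAlgClosed.splits (fullPoly n c a)).natDegree_eq_card_roots]
  refine natDegree_eq_of_degree_eq_some ?_
  rw [fullPoly, add_assoc, degree_add_eq_left_of_degree_lt, degree_X_pow]
  rw [degree_X_pow]
  exact degree_fullPoly_tail_lt hn c a

theorem exists_enumerates (A : Multiset ℂ) : ∃ u : Fin A.card → ℂ, Enumerates u A := by
  induction A using Quotient.inductionOn with
  | h l => exact ⟨l.get, (Fin.univ_val_map l.get).trans (congrArg _ (List.ofFn_get l))⟩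

theorem norm_eval_eq_prod {n : ℕ} {f : ℂ[X]} (hf : f.Monic) {v : Fin n → ℂ}
    (hv : Enumerates v f.roots) (z : ℂ) : ‖f.eval z‖ = ∏ j, ‖z - v j‖ := by
  rw [(IsAlgClosed.splits f).eval_eq_prod_roots_of_monic hf, ← hv, Multiset.map_map,
    ← norm_prod]
  rfl

/-- A monic polynomial which is small at as many well separated points as its degree has exactly
one root close to each of them. -/
theorem exists_enumerates_near {n : ℕ} {f : ℂ[X]} (hf : f.Monic) (hcard : f.roots.card = n)
    {z : Fin n → ℂ} {r : ℝ} (hr : 0 < r) (hz : ∀ i j, i ≠ j → 4 * r ≤ ‖z i - z j‖)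
    (hfz : ∀ k, ‖f.eval (z k)‖ ≤ r ^ n) :
    ∃ v : Fin n → ℂ, Enumerates v f.roots ∧ ∀ k, ‖z k - v k‖ ≤ r := by
  subst hcard
  obtain ⟨v, hv⟩ := exists_enumerates f.roots
  have hex : ∀ k, ∃ j, ‖z k - v j‖ ≤ r := by
    intro k
    by_contra! h
    -- If all roots were farther than `r` from `z k`, the product formula would give a value above
    -- `r ^ n`.
    have hlt : ∏ _j : Fin f.roots.card, r < ∏ j, ‖z k - v j‖ :=
      Finset.prod_lt_prod_of_nonempty (fun _ _ => hr) (fun j _ => h j) ⟨k, Finset.mem_univ k⟩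
    rw [← norm_eval_eq_prod hf hv, Finset.prod_const, Finset.card_univ, Fintype.card_fin] at hlt
    exact absurd (hfz k) (not_le.2 hlt)
  choose g hg using hex
  -- A root shared by two points would put them within `2 * r` of each other.
  have hinj : Function.Injective g := by
    intro i j hij
    by_contra hne
    have h1 := hz i j hne
    have h2 := hg i
    have h3 := hg j
    rw [hij] at h2
    have h4 : ‖z i - z j‖ ≤ ‖z i - v (g j)‖ + ‖z j - v (g j)‖ := by
      rw [show z i - z j = (z i - v (g j)) - (z j - v (g j)) by ring]
      exact norm_sub_le _ _
    linarith
  let σ := Equiv.ofBijective g (Finite.injective_iff_bijective.1 hinj)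
  refine ⟨v ∘ σ, ?_, hg⟩
  refine Eq.trans ?_ hv
  rw [← Multiset.map_map, Multiset.map_univ_val_equiv]

theorem frechetDistTuple_nonneg {m : ℕ} (u v : Fin m → ℂ) : 0 ≤ frechetDistTuple u v :=
  Real.iInf_nonneg fun _ => Real.iSup_nonneg fun _ => norm_nonneg _

theorem frechetDistTuple_le {m : ℕ} {u v : Fin m → ℂ} {d : ℝ} (hd : 0 ≤ d)
    (h : ∀ k, ‖u k - v k‖ ≤ d) : frechetDistTuple u v ≤ d :=
  (ciInf_le (Set.finite_range _).bddBelow (Equiv.refl (Fin m))).trans (Real.iSup_le h hd)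

theorem frechetDist_nonneg (A B : Multiset ℂ) : 0 ≤ frechetDist A B := by
  refine Real.sInf_nonneg ?_
  rintro _ ⟨m, u, v, -, -, rfl⟩
  exact frechetDistTuple_nonneg u v

theorem norm_sum_mul_pow_le (c : ℕ → ℂ) (m : ℕ) {z : ℂ} {M : ℝ} (hM : 1 ≤ M) (hz : ‖z‖ ≤ M) :
    ‖∑ k ∈ Finset.Icc 1 m, c k * z ^ k‖ ≤ (∑ k ∈ Finset.Icc 1 m, ‖c k‖) * M ^ m := by
  rw [Finset.sum_mul]
  refine norm_sum_le_of_le _ fun k hk => ?_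
  rw [norm_mul, norm_pow]
  refine mul_le_mul_of_nonneg_left ?_ (norm_nonneg _)
  exact (pow_le_pow_left₀ (norm_nonneg z) hz k).trans
    (pow_le_pow_right₀ hM (Finset.mem_Icc.1 hk).2)

theorem eval_fullPoly (n : ℕ) (c : ℕ → ℂ) (a z : ℂ) :
    (fullPoly n c a).eval z = z ^ n + ∑ k ∈ Finset.Icc 1 (n - 1), c k * z ^ k + a ^ n := by
  simp [fullPoly, eval_finsetSum]

/-- The terms of degree `n - 1` cancel; the resulting exponent `n - 2` is what makes the final bound
decay. -/
theorem norm_eval_fullPoly_sub_truncPoly_le {n : ℕ} (hn : 2 ≤ n) (c : ℕ → ℂ) (a : ℂ) {z : ℂ}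
    {M : ℝ} (hM : 1 ≤ M) (hz : ‖z‖ ≤ M) :
    ‖(fullPoly n c a).eval z - (truncPoly n c a).eval z‖
      ≤ (∑ k ∈ Finset.Icc 1 (n - 2), ‖c k‖) * M ^ (n - 2) := by
  convert norm_sum_mul_pow_le c (n - 2) hM hz using 2
  obtain ⟨m, rfl⟩ := Nat.exists_eq_add_of_le' hn
  rw [eval_fullPoly, show m + 2 - 1 = m + 1 from rfl, show m + 2 - 2 = m from rfl,
    Finset.sum_Icc_succ_top (by omega)]
  simp [truncPoly]

/-- If `ζ ^ n = -1`, the polynomial is small at `a * ζ` compared with `‖a‖ ^ n`. -/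
theorem eventually_norm_eval_fullPoly_le {n : ℕ} (hn : 2 ≤ n) (c : ℕ → ℂ) {s : ℝ} (hs : 0 < s) :
    ∀ᶠ a : ℂ in comap (fun a : ℂ => ‖a‖) atTop, ∀ ζ : ℂ, ζ ^ n = -1 →
      ‖(fullPoly n c a).eval (a * ζ)‖ ≤ (s * ‖a‖) ^ n := by
  set K := ∑ k ∈ Finset.Icc 1 (n - 1), ‖c k‖
  filter_upwards [tendsto_comap.eventually_ge_atTop (K / s ^ n),
    tendsto_comap.eventually_ge_atTop 1] with a ha ha1 ζ hζ
  have hζn : ‖ζ‖ = 1 := by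
    refine (pow_eq_one_iff_of_nonneg (norm_nonneg ζ) (by omega : n ≠ 0)).1 ?_
    rw [← norm_pow, hζ, norm_neg, norm_one]
  rw [div_le_iff₀ (pow_pos hs n)] at ha
  -- `(a * ζ) ^ n` cancels the constant term `a ^ n`.
  have he : (fullPoly n c a).eval (a * ζ) = ∑ k ∈ Finset.Icc 1 (n - 1), c k * (a * ζ) ^ k := by
    rw [eval_fullPoly, mul_pow a ζ n, hζ]
    ring
  rw [he]
  calc _ ≤ K * ‖a‖ ^ (n - 1) :=
        norm_sum_mul_pow_le c (n - 1) ha1 (by rw [norm_mul, hζn, mul_one])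
    _ ≤ (‖a‖ * s ^ n) * ‖a‖ ^ (n - 1) := by gcongr
    _ = (s * ‖a‖) ^ n := by
        rw [mul_pow, mul_right_comm, mul_pow_sub_one (by omega : n ≠ 0), mul_comm]

theorem exists_separated_roots_neg_one {n : ℕ} (hn : n ≠ 0) :
    ∃ (ζ : Fin n → ℂ) (s : ℝ), 0 < s ∧ s ≤ 1 ∧ (∀ k, ζ k ^ n = -1) ∧
      ∀ i j, i ≠ j → 4 * s ≤ ‖ζ i - ζ j‖ := by
  obtain ⟨η, hη⟩ := IsAlgClosed.exists_pow_nat_eq (-1 : ℂ) (Nat.pos_of_ne_zero hn)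
  have hω := Complex.isPrimitiveRoot_exp n hn
  set ω := Complex.exp (2 * Real.pi * Complex.I / n)
  have hη0 : η ≠ 0 := by
    rintro rfl
    rw [zero_pow hn] at hη
    norm_num at hη
  have hev : ∀ᶠ s : ℝ in 𝓝[>] 0, ∀ i j : Fin n, i ≠ j →
      s ≤ ‖η * ω ^ (i : ℕ) - η * ω ^ (j : ℕ)‖ / 4 := by
    refine eventually_all.2 fun i => eventually_all.2 fun j => ?_
    by_cases hij : i = j
    · simp [hij]
    have hne : η * ω ^ (i : ℕ) - η * ω ^ (j : ℕ) ≠ 0 := by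
      rw [sub_ne_zero]
      intro h
      exact hij (Fin.ext (hω.pow_inj i.2 j.2 (mul_left_cancel₀ hη0 h)))
    have hpos : 0 < ‖η * ω ^ (i : ℕ) - η * ω ^ (j : ℕ)‖ / 4 := by positivity
    filter_upwards [nhdsWithin_le_nhds (Iic_mem_nhds hpos)] with s hs _
    exact hs
  obtain ⟨s, ⟨hs, hs1⟩, hs0⟩ := ((hev.and
    (nhdsWithin_le_nhds (Iic_mem_nhds (zero_lt_one' ℝ)))).and self_mem_nhdsWithin).exists
  refine ⟨fun k => η * ω ^ (k : ℕ), s, hs0, hs1, fun k => ?_, fun i j hij => ?_⟩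
  · rw [mul_pow, hη, ← pow_mul, mul_comm (k : ℕ) n, pow_mul, hω.pow_eq_one, one_pow, mul_one]
  · have := hs i j hij
    linarith

/-- The Fréchet distance of the two multisets of roots is `O(1 / ‖a‖)`. -/
theorem exists_eventually_frechetDist_le {n : ℕ} (hn : 2 ≤ n) (c : ℕ → ℂ) :
    ∃ K : ℝ, ∀ᶠ a : ℂ in comap (fun a : ℂ => ‖a‖) atTop,
      frechetDist (truncPoly n c a).roots (fullPoly n c a).roots ≤ K / ‖a‖ := by
  obtain ⟨ζ, s, hs, hs1, hζ, hsep⟩ := exists_separated_roots_neg_one (by omega : n ≠ 0)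
  set L := ∑ k ∈ Finset.Icc 1 (n - 2), ‖c k‖
  have hL : 0 ≤ L := Finset.sum_nonneg fun _ _ => norm_nonneg _
  -- This is `L * (2 * ‖a‖) ^ (n - 2) / (s * ‖a‖) ^ (n - 1)` with the factor `1 / ‖a‖` removed.
  refine ⟨L * 2 ^ (n - 2) / s ^ (n - 1), ?_⟩
  filter_upwards [eventually_norm_eval_fullPoly_le hn c hs,
    eventually_norm_eval_fullPoly_le hn (fun k => if k = n - 1 then c k else 0) hs,
    tendsto_comap.eventually_ge_atTop 1] with a hfull htrunc ha
  simp_rw [← truncPoly_eq_fullPoly hn] at htrunc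
  have hr : 0 < s * ‖a‖ := by positivity
  have hz : ∀ i j, i ≠ j → 4 * (s * ‖a‖) ≤ ‖a * ζ i - a * ζ j‖ := by
    intro i j hij
    rw [← mul_sub, norm_mul]
    nlinarith [hsep i j hij]
  have hfm := fullPoly_monic hn c a
  have htm : (truncPoly n c a).Monic := truncPoly_eq_fullPoly hn c a ▸ fullPoly_monic hn _ a
  have htc : (truncPoly n c a).roots.card = n :=
    truncPoly_eq_fullPoly hn c a ▸ card_roots_fullPoly hn _ a
  obtain ⟨v, hv, hvz⟩ := exists_enumerates_near hfm (card_roots_fullPoly hn c a) hr hz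
    fun k => hfull _ (hζ k)
  obtain ⟨u, hu, huz⟩ := exists_enumerates_near htm htc hr hz fun k => htrunc _ (hζ k)
  rw [frechetDist_eq hu hv]
  refine frechetDistTuple_le (by positivity) fun k => ?_
  have hu0 : (truncPoly n c a).eval (u k) = 0 := by
    have hmem : u k ∈ (truncPoly n c a).roots := by
      rw [← hu]
      exact Multiset.mem_map_of_mem u (Finset.mem_univ k)
    exact isRoot_of_mem_roots hmem
  -- Here `s ≤ 1` is needed.
  have hun : ‖u k‖ ≤ 2 * ‖a‖ := by
    have hζn : ‖ζ k‖ = 1 := by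
      refine (pow_eq_one_iff_of_nonneg (norm_nonneg _) (by omega : n ≠ 0)).1 ?_
      rw [← norm_pow, hζ, norm_neg, norm_one]
    have h1 : ‖u k‖ ≤ ‖a * ζ k‖ + ‖a * ζ k - u k‖ := by
      simpa using norm_sub_le (a * ζ k) (a * ζ k - u k)
    rw [norm_mul, hζn] at h1
    nlinarith [huz k]
  have hup := norm_eval_fullPoly_sub_truncPoly_le hn c a (by linarith) hun
  rw [hu0, sub_zero, norm_eval_eq_prod hfm hv, ← Finset.mul_prod_erase _ _ (Finset.mem_univ k)]
    at hup
  -- Centres `4 * r` apart, with each root within `r` of its own centre, leave at least `2 * r ≥ r`,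
  -- where `r = s * ‖a‖`.
  have hlow : (s * ‖a‖) ^ (n - 1) ≤ ∏ j ∈ Finset.univ.erase k, ‖u k - v j‖ := by
    have hc : (Finset.univ.erase k).card = n - 1 := by simp
    rw [← hc, ← Finset.prod_const]
    refine Finset.prod_le_prod (fun _ _ => hr.le) fun j hj => ?_
    have h1 : ‖a * ζ k - a * ζ j‖ ≤ ‖a * ζ k - u k‖ + ‖u k - v j‖ + ‖a * ζ j - v j‖ := by
      rw [show a * ζ k - a * ζ j = (a * ζ k - u k) + (u k - v j) - (a * ζ j - v j) by ring]
      exact (norm_sub_le _ _).trans (add_le_add_left (norm_add_le _ _) _)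
    linarith [huz k, hvz j, hz k j (Finset.ne_of_mem_erase hj).symm]
  have hmain := (mul_le_mul_of_nonneg_left hlow (norm_nonneg (u k - v k))).trans hup
  rw [div_div, le_div_iff₀ (by positivity)]
  obtain ⟨m, rfl⟩ := Nat.exists_eq_add_of_le' hn
  rw [show m + 2 - 1 = m + 1 from rfl, show m + 2 - 2 = m from rfl] at *
  refine le_of_mul_le_mul_right (a := ‖a‖ ^ m) ?_ (by positivity)
  calc _ = ‖u k - v k‖ * (s * ‖a‖) ^ (m + 1) := by ring
    _ ≤ L * (2 * ‖a‖) ^ m := hmain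
    _ = _ := by ring

theorem mainTheorem8 (n : ℕ) (hn : 2 ≤ n) (c : ℕ → ℂ) :
    (∀ a : ℂ, (truncPoly n c a).roots.card = n ∧ (fullPoly n c a).roots.card = n) ∧
    Tendsto (fun a : ℂ => frechetDist (truncPoly n c a).roots (fullPoly n c a).roots)
      (comap (fun a : ℂ => ‖a‖) atTop) (𝓝 0) := by
  refine ⟨fun a => ⟨truncPoly_eq_fullPoly hn c a ▸ card_roots_fullPoly hn _ a,
    card_roots_fullPoly hn c a⟩, ?_⟩
  obtain ⟨K, hK⟩ := exists_eventually_frechetDist_le hn c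
  exact tendsto_of_tendsto_of_tendsto_of_le_of_le' tendsto_const_nhds
    (tendsto_comap.const_div_atTop K) (Eventually.of_forall fun _ => frechetDist_nonneg _ _) hK
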